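/- For a prime $p$ and a non-empty subset $S\subseteq GF(p)$, let $X_S$ be the hyperelliptic curve $y^2=f_S(x)$ over $GF(p)$, where $f_S(x)=\prod_{a\in S}(x-a)$, and let $|X_S(GF(p))|$ be the number of solutions $(x,y)\in GF(p)^2$ of $y^2=f_S(x)$ plus the number of $GF(p)$-rational points at infinity of the smooth projective model of $X_S$ (for odd $p$ there are two such points if $|S|$ is even and one if $|S|$ is odd). For a real number $c$, let $B(c,p)$ be the statement: for all non-empty subsets $S\subseteq GF(p)$, $|X_S(GF(p))|\le c\cdot p$. **Theorem.** For all sufficiently large primes $p$ with $p\equiv 1\pmod 4$, the statement $B(1.62,p)$ is false. That is, there is a constant $p_0$ such that for every prime $p>p_0$ with $p\equiv 1\pmod 4$ there exists a non-empty subset $S\subseteq GF(p)$ with $|X_S(GF(p))|>1.62\,p$. -/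

import Mathlib

open Polynomial

/-- The `K`-rational affine points of the curve `y ^ 2 = h(x)`. -/
def hyperellipticAffinePoints {K : Type*} [Field K] (h : K[X]) : Set (K × K) :=
  {P | P.2 ^ 2 = h.eval P.1}

/-- The `K`-rational points at infinity of the smooth projective model of `y ^ 2 = h(x)`, for a
nonconstant polynomial `h` with distinct roots. Put `m = ⌈deg h / 2⌉` (so that `m = g + 1` with `g`
the genus). In the coordinates `u = 1 / x`, `v = y / x ^ m` the curve reads
`v ^ 2 = u ^ (2 * m) * h(1 / u)`, and its points at infinity are those with `u = 0`, that is, the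
solutions `v` of `v ^ 2 = c` with `c` the coefficient of `x ^ (2 * m)` in `h`. Hence a monic `h` has
one point at infinity if its degree is odd and (in odd characteristic) two if its degree is
even. -/
def hyperellipticPointsAtInfinity {K : Type*} [Field K] (h : K[X]) : Set K :=
  {v | v ^ 2 = h.coeff (2 * ((h.natDegree + 1) / 2))}

/-- The number `|X(K)|` of `K`-rational points of the curve `X : y ^ 2 = h(x)`: the affine
solutions together with the points at infinity. -/
noncomputable def hyperellipticCard {K : Type*} [Field K] (h : K[X]) : ℕ :=
  (hyperellipticAffinePoints h).ncard + (hyperellipticPointsAtInfinity h).ncard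

/-- The polynomial `f_S(x) = ∏_{a ∈ S} (x - a)`. -/
noncomputable def subsetPoly {K : Type*} [Field K] (S : Finset K) : K[X] :=
  ∏ a ∈ S, (X - C a)

/-- The statement `B(c, p)`: for every non-empty subset `S` of `GF(p)`, the hyperelliptic curve
`X_S : y ^ 2 = f_S(x)` satisfies `|X_S(GF(p))| ≤ c * p`. -/
def BazziMitterBound (c : ℝ) (p : ℕ) [Fact p.Prime] : Prop :=
  ∀ S : Finset (ZMod p), S.Nonempty → (hyperellipticCard (subsetPoly S) : ℝ) ≤ c * (p : ℝ)

/-!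
The proof converts point counts into weights of a binary linear code of rate about `1 / 2` and
applies the first linear programming bound of McEliece, Rodemich, Rumsey and Welch to that code, in
the spectral form of Friedman and Tillich.

Let `χ` be the quadratic character. For `x ∈ GF(p)` and a sign `b`, let `σ_b` be the function with
`σ_b(0) = 1` and `σ_b = ±χ` elsewhere, and put `ε_{x,b}(S) = ∏_{a ∈ S} σ_b(x - a)`. For `S` of even
size, `∑_{x,b} ε_{x,b}(S) = 2 ∑_x χ(f_S(x))` (`sum_legendreSign`), because the two terms with a
given `x` agree if `x ∉ S` and cancel if `x ∈ S`. As `∑_x χ(f_S(x))` is the number of affine points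
minus `p`, the bound `B(1.62, p)` forces `∑_{x,b} ε_{x,b}(S) ≤ 0.62 n` with `n = 2p`, for all nonempty
even `S`.

The `n` functions `ε_j` are characters of the group of even subsets, which has order `2 ^ (p - 1)`.
Such a family cannot be so unbiased (`card_mul_le_of_subsolution`): let `f ≥ 0` be a function on the
cube of subsets of the index set, supported on a set `B` and with adjacency sums at least `λ f`, and
let `h(S) = ∑_u f(u) ∏_{j ∈ u} ε_j(S)`. Character sums are nonnegative, hence
`∑_S (∑_j ε_j(S) - λ) h(S)² ≥ 0`; if all the sums `∑_j ε_j(S)` with `S ≠ ∅` were at most `μ < λ`,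
the term of `S = ∅` would have to dominate, which Cauchy--Schwarz excludes unless
`(λ - μ) 2 ^ (p - 1) ≤ (n - μ) |B|`.

For `B` a Hamming ball of radius close to `49 n / 450`, a function `f` that is a geometric factor
times a parabola in the weight reaches `λ = 0.621 n > 0.62 n` (`radialWeight_subsolution`), while
`|B|` is exponentially smaller than `2 ^ p` (`card_ball_le`, `entropy_gap`).
-/

open Finset in
/-- Multiplicativity of Walsh monomials. -/
lemma prod_symmDiff_of_sq_eq_one {ι : Type*} [DecidableEq ι] (u w : Finset ι) (e : ι → ℝ)
    (he : ∀ j, e j ^ 2 = 1) :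
    ∏ j ∈ symmDiff u w, e j = (∏ j ∈ u, e j) * ∏ j ∈ w, e j := by
  have h1 : ∏ j ∈ symmDiff u w, e j = (∏ j ∈ u \ w, e j) * ∏ j ∈ w \ u, e j := by
    rw [symmDiff_def, sup_eq_union, prod_union]
    exact disjoint_sdiff_sdiff
  have h2 : (∏ j ∈ u ∩ w, e j) * (∏ j ∈ u ∩ w, e j) = 1 := by
    rw [← prod_mul_distrib]
    exact prod_eq_one fun j _ => by rw [← sq, he]
  rw [h1, ← prod_inter_mul_prod_sdiff u w, ← prod_inter_mul_prod_sdiff w u, inter_comm w u]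
  linear_combination -(∏ j ∈ u \ w, e j) * (∏ j ∈ w \ u, e j) * h2

/-! ### The spectral bound -/

section Spectral

variable {ι α : Type*} [Fintype ι] [DecidableEq ι]

/-- The Walsh transform `∑_u f(u) ∏_{j ∈ u} e_j` of a function `f` on the cube of subsets of `ι`, at
the point `e`. -/
noncomputable def walshSum (f : Finset ι → ℝ) (e : ι → ℝ) : ℝ :=
  ∑ u, f u * ∏ j ∈ u, e j

/-- The adjacency operator of the cube of subsets of `ι`. -/
noncomputable def cubeAdj (f : Finset ι → ℝ) (u : Finset ι) : ℝ :=
  ∑ j, f (symmDiff u {j})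

/-- The Walsh transform diagonalizes the adjacency operator. -/
lemma sum_mul_walshSum (f : Finset ι → ℝ) (e : ι → ℝ) (he : ∀ j, e j ^ 2 = 1) :
    (∑ j, e j) * walshSum f e = walshSum (cubeAdj f) e := by
  unfold walshSum cubeAdj
  simp_rw [Finset.sum_mul, Finset.mul_sum]
  conv_rhs => rw [Finset.sum_comm]
  refine Finset.sum_congr rfl fun j _ => ?_
  have hinv : Function.Involutive (fun u : Finset ι => symmDiff u {j}) := fun u => by
    simp
  refine Fintype.sum_equiv (Function.Involutive.toPerm _ hinv) _ _ fun u => ?_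
  rw [Function.Involutive.coe_toPerm, symmDiff_symmDiff_cancel_right,
    prod_symmDiff_of_sq_eq_one _ _ _ he, Finset.prod_singleton]
  ring

/-- Summing a product of two Walsh transforms over a family of points. -/
lemma sum_walshSum_mul_walshSum (A : Finset α) (ε : ι → α → ℝ) (hε : ∀ j v, ε j v ^ 2 = 1)
    (f g : Finset ι → ℝ) :
    ∑ v ∈ A, walshSum f (ε · v) * walshSum g (ε · v) =
      ∑ u, ∑ w, f u * g w * ∑ v ∈ A, ∏ j ∈ symmDiff u w, ε j v := by
  simp_rw [walshSum, Finset.sum_mul_sum, Finset.mul_sum]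
  rw [Finset.sum_comm]
  refine Finset.sum_congr rfl fun u _ => ?_
  rw [Finset.sum_comm]
  refine Finset.sum_congr rfl fun w _ => Finset.sum_congr rfl fun v _ => ?_
  rw [prod_symmDiff_of_sq_eq_one _ _ _ fun j => hε j v]
  ring

/-- Spectral form of the linear programming bound. The hypothesis `hpos` holds when `A` is a finite
group and the `ε j` are characters of it; then `∑ j, ε j v` are the eigenvalues of a Cayley graph on
the dual group, and `walshSum f` is the transform of a nonnegative function on that group with
support of size at most `#B`. -/
lemma card_mul_le_of_subsolution [DecidableEq α] (A : Finset α) (v₀ : α) (hv₀ : v₀ ∈ A)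
    (ε : ι → α → ℝ) (hε : ∀ j v, ε j v ^ 2 = 1) (hε₀ : ∀ j, ε j v₀ = 1)
    (hpos : ∀ u : Finset ι, 0 ≤ ∑ v ∈ A, ∏ j ∈ u, ε j v)
    (f : Finset ι → ℝ) (hf : ∀ u, 0 ≤ f u) (hf₀ : ∃ u, f u ≠ 0)
    (B : Finset (Finset ι)) (hB : ∀ u, f u ≠ 0 → u ∈ B)
    {lam mu : ℝ} (hsub : ∀ u, lam * f u ≤ cubeAdj f u)
    (hmu : ∀ v ∈ A, v ≠ v₀ → ∑ j, ε j v ≤ mu) (hlt : mu < lam)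
    (hn : mu ≤ Fintype.card ι) :
    (lam - mu) * (A.card : ℝ) ≤ (Fintype.card ι - mu) * (B.card : ℝ) := by
  have hdiag : (A.card : ℝ) * ∑ u, f u ^ 2 ≤ ∑ v ∈ A, walshSum f (ε · v) ^ 2 := by
    simp_rw [sq (walshSum f _)]
    rw [sum_walshSum_mul_walshSum A ε hε, Finset.mul_sum]
    refine Finset.sum_le_sum fun u _ => ?_
    refine le_trans (le_of_eq ?_) (Finset.single_le_sum (fun w _ =>
      mul_nonneg (mul_nonneg (hf u) (hf w)) (hpos _)) (Finset.mem_univ u))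
    simp
    ring
  have hspec : 0 ≤ ∑ v ∈ A, (∑ j, ε j v - lam) * walshSum f (ε · v) ^ 2 := by
    have h : ∀ v, (∑ j, ε j v - lam) * walshSum f (ε · v) ^ 2 =
        walshSum (fun u => cubeAdj f u - lam * f u) (ε · v) * walshSum f (ε · v) := by
      intro v
      have h1 : walshSum (fun u => cubeAdj f u - lam * f u) (ε · v) =
          walshSum (cubeAdj f) (ε · v) - lam * walshSum f (ε · v) := by
        simp only [walshSum, sub_mul, Finset.sum_sub_distrib, Finset.mul_sum, mul_assoc]
      rw [h1, ← sum_mul_walshSum f _ fun j => hε j v]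
      ring
    simp_rw [h]
    rw [sum_walshSum_mul_walshSum A ε hε]
    exact Finset.sum_nonneg fun u _ => Finset.sum_nonneg fun w _ =>
      mul_nonneg (mul_nonneg (sub_nonneg.2 (hsub u)) (hf w)) (hpos _)
  have hzero : walshSum f (ε · v₀) ^ 2 ≤ B.card * ∑ u, f u ^ 2 := by
    have h1 : walshSum f (ε · v₀) = ∑ u ∈ B, f u := by
      simp only [walshSum, hε₀, Finset.prod_const_one, mul_one]
      refine (Finset.sum_subset (Finset.subset_univ B) fun u _ hu => ?_).symm
      by_contra h
      exact hu (hB u h)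
    rw [h1]
    refine sq_sum_le_card_mul_sum_sq.trans (mul_le_mul_of_nonneg_left ?_ (Nat.cast_nonneg _))
    exact Finset.sum_le_sum_of_subset_of_nonneg (Finset.subset_univ B) fun u _ _ => sq_nonneg (f u)
  have hsplit : (lam - mu) * ∑ v ∈ A, walshSum f (ε · v) ^ 2 ≤
      (Fintype.card ι - mu) * walshSum f (ε · v₀) ^ 2 := by
    rw [← Finset.add_sum_erase A _ hv₀] at hspec ⊢
    have h1 : ∑ v ∈ A.erase v₀, (∑ j, ε j v - lam) * walshSum f (ε · v) ^ 2 ≤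
        (mu - lam) * ∑ v ∈ A.erase v₀, walshSum f (ε · v) ^ 2 := by
      rw [Finset.mul_sum]
      refine Finset.sum_le_sum fun v hv => mul_le_mul_of_nonneg_right ?_ (sq_nonneg _)
      have := hmu v (Finset.mem_of_mem_erase hv) (Finset.ne_of_mem_erase hv)
      linarith
    have h2 : ∑ j, ε j v₀ = Fintype.card ι := by simp [hε₀]
    rw [h2] at hspec
    linarith
  have hF : 0 < ∑ u, f u ^ 2 := by
    obtain ⟨u, hu⟩ := hf₀
    exact Finset.sum_pos' (fun u _ => sq_nonneg (f u)) ⟨u, Finset.mem_univ u, pow_pos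
      ((hf u).lt_of_ne' hu) 2⟩
  refine le_of_mul_le_mul_right ?_ hF
  calc (lam - mu) * (A.card : ℝ) * ∑ u, f u ^ 2
      = (lam - mu) * ((A.card : ℝ) * ∑ u, f u ^ 2) := by ring
    _ ≤ (lam - mu) * ∑ v ∈ A, walshSum f (ε · v) ^ 2 :=
        mul_le_mul_of_nonneg_left hdiag (by linarith)
    _ ≤ (Fintype.card ι - mu) * walshSum f (ε · v₀) ^ 2 := hsplit
    _ ≤ (Fintype.card ι - mu) * (B.card * ∑ u, f u ^ 2) :=
        mul_le_mul_of_nonneg_left hzero (by linarith)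
    _ = _ := by ring

/-! ### A radial subsolution on a Hamming ball -/

lemma cubeAdj_card (φ : ℕ → ℝ) (u : Finset ι) :
    cubeAdj (fun w => φ w.card) u =
      u.card * φ (u.card - 1) + (Fintype.card ι - u.card) * φ (u.card + 1) := by
  have h1 : ∀ j ∈ u, φ (symmDiff u {j}).card = φ (u.card - 1) := fun j hj => by
    have : symmDiff u {j} = u.erase j := by
      ext x; simp only [Finset.mem_symmDiff, Finset.mem_singleton, Finset.mem_erase]; grind
    rw [this, Finset.card_erase_of_mem hj]
  have h2 : ∀ j ∈ uᶜ, φ (symmDiff u {j}).card = φ (u.card + 1) := fun j hj => by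
    have hj' : j ∉ u := by simpa using hj
    have : symmDiff u {j} = insert j u := by
      ext x; simp only [Finset.mem_symmDiff, Finset.mem_singleton, Finset.mem_insert]; grind
    rw [this, Finset.card_insert_of_notMem hj']
  rw [cubeAdj, ← Finset.sum_add_sum_compl u, Finset.sum_congr rfl h1, Finset.sum_congr rfl h2]
  simp [Finset.card_compl, Nat.cast_sub (Finset.card_le_univ u)]

end Spectral

/-- The number of points of a Hamming ball, by comparison with a binomial expansion. -/
lemma card_ball_le {ι : Type*} [Fintype ι] (r : ℕ) {τ : ℝ} (hτ : 0 < τ) (hτ1 : τ ≤ 1) :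
    ((Finset.univ.filter fun u : Finset ι => u.card ≤ r).card : ℝ) * τ ^ r ≤
      (1 + τ) ^ Fintype.card ι := by
  have h := Finset.sum_pow_mul_eq_add_pow τ 1 (Finset.univ : Finset ι)
  simp only [one_pow, mul_one, Finset.powerset_univ, Finset.card_univ] at h
  rw [add_comm 1 τ, ← h, ← nsmul_eq_mul, ← Finset.sum_const]
  calc ∑ _u ∈ Finset.univ.filter (fun u : Finset ι => u.card ≤ r), τ ^ r
      ≤ ∑ u ∈ Finset.univ.filter (fun u : Finset ι => u.card ≤ r), τ ^ u.card :=
        Finset.sum_le_sum fun u hu =>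
          pow_le_pow_of_le_one hτ.le hτ1 (Finset.mem_filter.1 hu).2
    _ ≤ _ := Finset.sum_le_sum_of_subset_of_nonneg (Finset.subset_univ _)
        fun _ _ _ => by positivity

/-- A geometric factor times a parabola that is positive exactly on `R < i < R + M + 1`. The ratio
`7 / 20` balances the contributions of the two neighbouring weights when `i / n` is near
`49 / 449`. -/
noncomputable def radialWeight (R M i : ℕ) : ℝ :=
  (7 / 20) ^ i * max 0 (((i : ℝ) - R) * (R + M + 1 - i))

lemma radialWeight_nonneg (R M i : ℕ) : 0 ≤ radialWeight R M i :=
  mul_nonneg (by positivity) (le_max_left _ _)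

lemma lt_and_le_of_radialWeight_ne_zero {R M i : ℕ} (h : radialWeight R M i ≠ 0) :
    R < i ∧ i ≤ R + M := by
  have h1 : 0 < ((i : ℝ) - R) * (R + M + 1 - i) := by
    by_contra! hle
    exact h (by rw [radialWeight, max_eq_left hle, mul_zero])
  rcases pos_and_pos_or_neg_and_neg_of_mul_pos h1 with ⟨ha, hb⟩ | ⟨ha, hb⟩
  · have ha' : (R : ℝ) < i := by linarith
    have hb' : (i : ℝ) < (R + M + 1 : ℕ) := by push_cast; linarith
    exact ⟨by exact_mod_cast ha', Nat.lt_succ_iff.1 (by exact_mod_cast hb')⟩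
  · have : (0 : ℝ) ≤ M := M.cast_nonneg
    linarith

/-- The second difference of the parabola is `-2`, and its values at the integers of the window are
at least `M`; hence the sum of the two neighbouring values is at least `2 * (1 - 1 / M)` times the
value itself. -/
lemma radialWeight_subsolution {n R M : ℕ} (hR : 49 * n ≤ 450 * (R + 1)) (hn : 9 * (R + M) ≤ n)
    (hM : 1000 ≤ M) (i : ℕ) (hi : i ≤ n) :
    0.621 * n * radialWeight R M i ≤
      i * radialWeight R M (i - 1) + (n - i) * radialWeight R M (i + 1) := by
  have hin : (i : ℝ) ≤ n := by exact_mod_cast hi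
  by_cases h : radialWeight R M i = 0
  · rw [h, mul_zero]
    exact add_nonneg (mul_nonneg (by positivity) (radialWeight_nonneg _ _ _))
      (mul_nonneg (by linarith) (radialWeight_nonneg _ _ _))
  obtain ⟨h1, h2⟩ := lt_and_le_of_radialWeight_ne_zero h
  obtain ⟨k, rfl⟩ : ∃ k, i = R + 1 + k := ⟨i - (R + 1), by omega⟩
  obtain ⟨l, hl⟩ : ∃ l, R + M = R + 1 + k + l := ⟨R + M - (R + 1 + k), by omega⟩
  obtain rfl : M = 1 + k + l := by omega
  have hM' : (1000 : ℝ) ≤ 1 + k + l := by exact_mod_cast hM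
  have hR' : (49 * n : ℝ) ≤ 450 * (R + 1) := by exact_mod_cast hR
  have hn' : (9 * (R + (1 + k + l)) : ℝ) ≤ n := by exact_mod_cast hn
  have hk : (0 : ℝ) ≤ k := k.cast_nonneg
  have hl : (0 : ℝ) ≤ l := l.cast_nonneg
  have hRn : (0 : ℝ) ≤ R := R.cast_nonneg
  have e0 : radialWeight R (1 + k + l) (R + 1 + k) =
      (7 / 20) ^ (R + k) * (7 / 20 * ((k + 1) * (l + 1))) := by
    rw [radialWeight, max_eq_right]
    · push_cast; ring
    · push_cast
      have : ((R : ℝ) + 1 + k - R) * (R + (1 + k + l) + 1 - (R + 1 + k)) = (k + 1) * (l + 1) := by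
        ring
      rw [this]; positivity
  have e1 : radialWeight R (1 + k + l) (R + 1 + k - 1) =
      (7 / 20) ^ (R + k) * (k * (l + 2)) := by
    rw [show R + 1 + k - 1 = R + k by omega, radialWeight, max_eq_right]
    · push_cast; ring
    · push_cast
      have : ((R : ℝ) + k - R) * (R + (1 + k + l) + 1 - (R + k)) = k * (l + 2) := by
        ring
      rw [this]; positivity
  have e2 : radialWeight R (1 + k + l) (R + 1 + k + 1) =
      (7 / 20) ^ (R + k) * (49 / 400 * ((k + 2) * l)) := by
    rw [radialWeight, max_eq_right]
    · push_cast; ring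
    · push_cast
      have : ((R : ℝ) + 1 + k + 1 - R) * (R + (1 + k + l) + 1 - (R + 1 + k + 1)) = (k + 2) * l := by
        ring
      rw [this]; positivity
  rw [e0, e1, e2]
  push_cast
  have key : 0.621 * n * (7 / 20 * ((k + 1) * (l + 1)) : ℝ) ≤
      (R + 1 + k) * (k * (l + 2)) + (n - (R + 1 + k)) * (49 / 400 * ((k + 2) * l)) := by
    have t1 : (49 / 450 * n : ℝ) * (k * (l + 2)) ≤ (R + 1 + k) * (k * (l + 2)) :=
      mul_le_mul_of_nonneg_right (by linarith) (by positivity)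
    have t2 : (400 / 450 * n : ℝ) * (49 / 400 * ((k + 2) * l)) ≤
        (n - (R + 1 + k)) * (49 / 400 * ((k + 2) * l)) :=
      mul_le_mul_of_nonneg_right (by linarith) (by positivity)
    have t3 : (0 : ℝ) ≤ n * (k * l + k + l - 999) :=
      mul_nonneg n.cast_nonneg (by nlinarith [mul_nonneg hk hl])
    have t4 : (0 : ℝ) ≤ n * (k * l) := by positivity
    have t5 : (0 : ℝ) ≤ n * k := by positivity
    have t6 : (0 : ℝ) ≤ n * l := by positivity
    have t7 : (0 : ℝ) ≤ n := by positivity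
    nlinarith
  calc _ = (7 / 20 : ℝ) ^ (R + k) * (0.621 * n * (7 / 20 * ((k + 1) * (l + 1)))) := by ring
    _ ≤ (7 / 20 : ℝ) ^ (R + k) * _ := mul_le_mul_of_nonneg_left key (by positivity)
    _ = _ := by ring

/-! ### Even subsets and products of signs -/

section EvenSubsets

variable {K : Type*} [Fintype K] [DecidableEq K]

/-- The even subsets of a finite type. -/
def evenSubsets (K : Type*) [Fintype K] [DecidableEq K] : Finset (Finset K) :=
  Finset.univ.filter fun S => Even S.card

lemma two_mul_sum_evenSubsets (w : K → ℝ) :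
    2 * ∑ S ∈ evenSubsets K, ∏ a ∈ S, w a = ∏ a, (1 + w a) + ∏ a, (1 - w a) := by
  have h : ∀ w : K → ℝ, ∏ a, (1 + w a) = ∑ S : Finset K, ∏ a ∈ S, w a := fun w => by
    rw [Finset.prod_one_add, Finset.powerset_univ]
  simp_rw [sub_eq_add_neg]
  rw [h, h, ← Finset.sum_add_distrib, evenSubsets, Finset.sum_filter, Finset.mul_sum]
  refine Finset.sum_congr rfl fun S _ => ?_
  rw [Finset.prod_neg]
  split_ifs with hS
  · rw [hS.neg_one_pow]; ring
  · rw [(Nat.not_even_iff_odd.1 hS).neg_one_pow]; ring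

lemma sum_evenSubsets_nonneg (w : K → ℝ) (hw : ∀ a, w a ^ 2 = 1) :
    0 ≤ ∑ S ∈ evenSubsets K, ∏ a ∈ S, w a := by
  have h1 : 0 ≤ ∏ a, (1 + w a) := Finset.prod_nonneg fun a _ => by nlinarith [hw a]
  have h2 : 0 ≤ ∏ a, (1 - w a) := Finset.prod_nonneg fun a _ => by nlinarith [hw a]
  linarith [two_mul_sum_evenSubsets w]

lemma two_mul_card_evenSubsets [Nonempty K] :
    2 * ((evenSubsets K).card : ℝ) = 2 ^ Fintype.card K := by
  have h := two_mul_sum_evenSubsets (fun _ : K => (1 : ℝ))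
  have h0 : Fintype.card K ≠ 0 := Fintype.card_ne_zero
  simp [h0] at h
  rw [h]
  norm_num

end EvenSubsets

/-! ### Legendre signs and point counts -/

section Legendre

variable {K : Type*} [Field K] [Fintype K] [DecidableEq K]

/-- The quadratic character (for `b = true`) or its negative (for `b = false`), with the value at
`0` changed to `1` so that all values are signs. -/
noncomputable def signedChar (b : Bool) (y : K) : ℝ :=
  if y = 0 then 1 else (if b then 1 else -1) * (quadraticChar K y : ℝ)

/-- The coordinates of the codeword of `S`, written multiplicatively. -/
noncomputable def legendreSign (j : K × Bool) (S : Finset K) : ℝ :=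
  ∏ a ∈ S, signedChar j.2 (j.1 - a)

lemma signedChar_sq (b : Bool) (y : K) : signedChar b y ^ 2 = 1 := by
  unfold signedChar
  split_ifs with h hb
  · norm_num
  · rw [one_mul]; exact_mod_cast quadraticChar_sq_one h
  · rw [neg_one_mul, neg_sq]; exact_mod_cast quadraticChar_sq_one h

lemma legendreSign_sq (j : K × Bool) (S : Finset K) : legendreSign j S ^ 2 = 1 := by
  rw [legendreSign, ← Finset.prod_pow]
  exact Finset.prod_eq_one fun a _ => signedChar_sq _ _

lemma sum_prod_legendreSign_nonneg (u : Finset (K × Bool)) :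
    0 ≤ ∑ S ∈ evenSubsets K, ∏ j ∈ u, legendreSign j S := by
  have h : ∀ S : Finset K, ∏ j ∈ u, legendreSign j S =
      ∏ a ∈ S, ∏ j ∈ u, signedChar j.2 (j.1 - a) := fun S => Finset.prod_comm
  simp_rw [h]
  refine sum_evenSubsets_nonneg _ fun a => ?_
  rw [← Finset.prod_pow]
  exact Finset.prod_eq_one fun j _ => signedChar_sq _ _

/-- The two coordinates of `S` at `x` agree if `x ∉ S` and are opposite if `x ∈ S`. -/
lemma legendreSign_add (x : K) (S : Finset K) (hS : Even S.card) :
    legendreSign (x, true) S + legendreSign (x, false) S =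
      2 * (quadraticChar K ((subsetPoly S).eval x) : ℝ) := by
  have heval : (subsetPoly S).eval x = ∏ a ∈ S, (x - a) := by
    simp [subsetPoly, eval_prod]
  -- Away from `a = x` the factors of the two coordinates are opposite.
  have hneg : ∀ T : Finset K, x ∉ T → legendreSign (x, false) T =
      (-1) ^ T.card * legendreSign (x, true) T := fun T hT => by
    rw [legendreSign, legendreSign, ← Finset.prod_neg]
    refine Finset.prod_congr rfl fun a ha => ?_
    have : x - a ≠ 0 := sub_ne_zero.2 fun h => hT (h ▸ ha)
    simp [signedChar, this]
  by_cases hx : x ∈ S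
  · have hins : ∀ b, legendreSign (x, b) S = legendreSign (x, b) (S.erase x) := fun b => by
      rw [legendreSign, ← Finset.mul_prod_erase S _ hx]
      simp [signedChar, legendreSign]
    have hodd : Odd (S.erase x).card := by
      rw [Finset.card_erase_of_mem hx]
      exact Nat.Even.sub_odd (Finset.card_pos.2 ⟨x, hx⟩) hS odd_one
    rw [hins, hins, hneg _ (Finset.notMem_erase x S), hodd.neg_one_pow, heval,
      Finset.prod_eq_zero hx (sub_self x)]
    simp
  · rw [hneg S hx, hS.neg_one_pow, heval, map_prod, Int.cast_prod, one_mul, ← two_mul]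
    congr 1
    refine Finset.prod_congr rfl fun a ha => ?_
    have : x - a ≠ 0 := sub_ne_zero.2 fun h => hx (h ▸ ha)
    simp [signedChar, this]

lemma sum_legendreSign (S : Finset K) (hS : Even S.card) :
    ∑ j, legendreSign j S = 2 * ∑ x, (quadraticChar K ((subsetPoly S).eval x) : ℝ) := by
  rw [Fintype.sum_prod_type, Finset.mul_sum]
  refine Finset.sum_congr rfl fun x _ => ?_
  rw [Fintype.sum_bool, legendreSign_add x S hS]

lemma ncard_hyperellipticAffinePoints (hK : ringChar K ≠ 2) (h : K[X]) :
    ((hyperellipticAffinePoints h).ncard : ℝ) =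
      Fintype.card K + ∑ x, (quadraticChar K (h.eval x) : ℝ) := by
  have h1 : (hyperellipticAffinePoints h).ncard =
      ∑ x : K, (Finset.univ.filter fun y : K => y ^ 2 = h.eval x).card := by
    rw [← Finset.card_sigma, ← Set.ncard_coe_finset]
    refine Set.ncard_congr (fun P _ => ⟨P.1, P.2⟩) ?_ ?_ ?_
    · intro P hP
      simpa [hyperellipticAffinePoints] using hP
    · rintro ⟨a, b⟩ ⟨c, d⟩ _ _ h
      simpa using h
    · rintro ⟨a, b⟩ hb
      exact ⟨(a, b), by simpa [hyperellipticAffinePoints] using hb, rfl⟩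
  have h2 : ∀ x : K, ((Finset.univ.filter fun y : K => y ^ 2 = h.eval x).card : ℝ) =
      (quadraticChar K (h.eval x) : ℝ) + 1 := fun x => by
    have := quadraticChar_card_sqrts hK (h.eval x)
    have h3 : {y : K | y ^ 2 = h.eval x}.toFinset =
        Finset.univ.filter fun y : K => y ^ 2 = h.eval x := by ext; simp
    rw [h3] at this
    exact_mod_cast this
  rw [h1, Nat.cast_sum, Finset.sum_congr rfl fun x _ => h2 x, Finset.sum_add_distrib]
  simp [add_comm]

end Legendre

/-! ### Numerical estimates and conclusion -/

set_option exponentiation.threshold 1000 in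
/-- The bound of `card_ball_le` with `τ = 49 / 400`, for the radius `49 n / 450`, is exponentially
smaller than `2 ^ (n / 2)`. This is the case `n = 450`, where the radius is an integer; a factor `2` is
left to absorb constants. -/
lemma entropy_gap :
    2 * ((449 / 400 : ℝ) ^ 450 * (400 / 49) ^ 49) < 2 ^ 225 := by
  norm_num

lemma eventually_lt_two_pow (C : ℝ) :
    ∃ p₀ : ℕ, ∀ p : ℕ, p₀ < p →
      C * ((449 / 400 : ℝ) ^ 450 * (400 / 49) ^ 49) ^ p < (2 ^ 225) ^ p := by
  obtain ⟨N, hN⟩ := pow_unbounded_of_one_lt C (one_lt_two : (1 : ℝ) < 2)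
  refine ⟨N, fun p hp => ?_⟩
  calc C * ((449 / 400 : ℝ) ^ 450 * (400 / 49) ^ 49) ^ p
      < 2 ^ p * ((449 / 400 : ℝ) ^ 450 * (400 / 49) ^ 49) ^ p :=
        mul_lt_mul_of_pos_right (hN.trans_le (pow_le_pow_right₀ one_le_two hp.le)) (by positivity)
    _ = (2 * ((449 / 400 : ℝ) ^ 450 * (400 / 49) ^ 49)) ^ p := (mul_pow _ _ _).symm
    _ ≤ _ := pow_le_pow_left₀ (by positivity) entropy_gap.le p

/-- The spectral bound for the Legendre signs: under `B(1.62, p)` the group of even subsets has at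
most `1000` times as many elements as the Hamming ball. -/
lemma two_pow_le_of_bazziMitterBound {p : ℕ} [Fact p.Prime] (hp : 225000 < p)
    (h : BazziMitterBound 1.62 p) :
    (2 : ℝ) ^ p ≤ 2000 * ((Finset.univ.filter fun u : Finset (ZMod p × Bool) =>
      u.card ≤ 49 * (2 * p) / 450 + 1000).card : ℝ) := by
  set R := 49 * (2 * p) / 450
  have hp0 : (0 : ℝ) < p := by exact_mod_cast (by omega : 0 < p)
  have hchar : ringChar (ZMod p) ≠ 2 := by
    rw [ZMod.ringChar_zmod_n]; omega
  have hcard : Fintype.card (ZMod p × Bool) = 2 * p := by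
    simp [ZMod.card, mul_comm]
  -- With `n = 2 * p`, the constant `1000` arises as `n / (0.621 * n - 0.62 * n)`.
  have key := card_mul_le_of_subsolution (evenSubsets (ZMod p)) ∅ (by simp [evenSubsets])
    legendreSign legendreSign_sq (fun j => by simp [legendreSign]) sum_prod_legendreSign_nonneg
    (fun u => radialWeight R 1000 u.card) (fun u => radialWeight_nonneg _ _ _) ?_
    (Finset.univ.filter fun u => u.card ≤ R + 1000)
    (fun u hu => by simpa using (lt_and_le_of_radialWeight_ne_zero hu).2)
    (lam := 0.621 * (2 * p : ℕ)) (mu := 0.62 * (2 * p : ℕ)) ?_ ?_ ?_ ?_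
  · have h2 := two_mul_card_evenSubsets (K := ZMod p)
    rw [ZMod.card] at h2
    rw [← h2]
    rw [hcard] at key
    push_cast at key
    set a : ℝ := ((evenSubsets (ZMod p)).card : ℝ)
    set b : ℝ := ((Finset.univ.filter fun u : Finset (ZMod p × Bool) =>
      u.card ≤ R + 1000).card : ℝ)
    have hb : 0 ≤ b := Nat.cast_nonneg _
    have h3 : p * (0.002 * a) ≤ p * (2 * b) := by nlinarith [mul_nonneg hp0.le hb]
    have := le_of_mul_le_mul_left h3 hp0
    linarith
  · obtain ⟨u, -, hu⟩ := Finset.exists_subset_card_eq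
      (s := (Finset.univ : Finset (ZMod p × Bool))) (n := R + 1)
      (by rw [Finset.card_univ, hcard]; omega)
    refine ⟨u, ?_⟩
    rw [hu, radialWeight, max_eq_right (by push_cast; ring_nf; norm_num)]
    push_cast
    ring_nf
    positivity
  · intro u
    rw [cubeAdj_card (radialWeight R 1000), hcard]
    exact radialWeight_subsolution (by omega) (by omega) le_rfl _
      (hcard ▸ Finset.card_le_univ u)
  · intro S hS hne
    have hB := h S (Finset.nonempty_iff_ne_empty.2 hne)
    rw [hyperellipticCard, Nat.cast_add, ncard_hyperellipticAffinePoints hchar, ZMod.card] at hB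
    rw [sum_legendreSign S (by simpa [evenSubsets] using hS)]
    have := Nat.cast_nonneg (α := ℝ) (hyperellipticPointsAtInfinity (subsetPoly S)).ncard
    push_cast
    linarith
  · push_cast; linarith
  · rw [hcard]; push_cast; linarith

theorem mainTheorem2 :
    ∃ p₀ : ℕ, ∀ (p : ℕ) [Fact p.Prime], p₀ < p → p % 4 = 1 →
      ¬ BazziMitterBound 1.62 p := by
  obtain ⟨N, hN⟩ := eventually_lt_two_pow ((2000 * (400 / 49) ^ 1000) ^ 225)
  refine ⟨max N 225000, fun p _ hp _ hB => ?_⟩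
  have h1 := two_pow_le_of_bazziMitterBound ((le_max_right _ _).trans_lt hp) hB
  set R := 49 * (2 * p) / 450 with hR
  have h2 := card_ball_le (ι := ZMod p × Bool) (R + 1000) (τ := 49 / 400) (by norm_num)
    (by norm_num)
  set b : ℝ := ((Finset.univ.filter fun u : Finset (ZMod p × Bool) =>
    u.card ≤ R + 1000).card : ℝ)
  have hcard : Fintype.card (ZMod p × Bool) = 2 * p := by
    simp [ZMod.card, mul_comm]
  rw [hcard, show (1 + 49 / 400 : ℝ) = 449 / 400 by norm_num] at h2
  have h3 : (2 : ℝ) ^ p ≤ 2000 * ((449 / 400) ^ (2 * p) * (400 / 49) ^ (R + 1000)) := by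
    refine h1.trans (mul_le_mul_of_nonneg_left ?_ (by norm_num))
    calc b = b * (49 / 400) ^ (R + 1000) * (400 / 49) ^ (R + 1000) := by
          rw [mul_assoc, ← mul_pow]; norm_num
      _ ≤ _ := mul_le_mul_of_nonneg_right h2 (by positivity)
  -- The `225`-th power turns the rounded radius into an integral exponent of `400 / 49`.
  have h4 := pow_le_pow_left₀ (by positivity) h3 225
  have h5 : ((400 / 49 : ℝ) ^ R) ^ 225 ≤ ((400 / 49) ^ 49) ^ p := by
    rw [← pow_mul, ← pow_mul]
    exact pow_le_pow_right₀ (by norm_num) (by omega)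
  refine absurd (hN p ((le_max_left _ _).trans_lt hp)) (not_lt.2 ?_)
  calc ((2 : ℝ) ^ 225) ^ p = (2 ^ p) ^ 225 := pow_right_comm _ _ _
    _ ≤ _ := h4
    _ = (2000 * (400 / 49) ^ 1000) ^ 225 *
          (((449 / 400) ^ 450) ^ p * ((400 / 49 : ℝ) ^ R) ^ 225) := by
        rw [pow_add, mul_pow, mul_pow, mul_pow, mul_pow, ← pow_mul (449 / 400 : ℝ),
          ← pow_mul (449 / 400 : ℝ), show 2 * p * 225 = 450 * p by ring]
        generalize ((400 / 49 : ℝ) ^ 1000) = c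
        ring
    _ ≤ (2000 * (400 / 49) ^ 1000) ^ 225 * (((449 / 400) ^ 450) ^ p * ((400 / 49) ^ 49) ^ p) := by
        gcongr
    _ = _ := by rw [← mul_pow]
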